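/- An abstract numeration system is a triple $(L,A,<)$ where $L$ is an infinite regular language over a finite totally ordered alphabet $(A,<)$; for $n\in\mathbb{N}$, $\mathrm{rep}(n)$ is the $n$-th word of $L$ (counted from $0$) in the radix order (shorter words first, words of equal length in lexicographic order), and $\mathrm{val}\colon L\to\mathbb{N}$ is the inverse of $\mathrm{rep}$. Let $\boldsymbol{\mathcal S}=(\mathcal S_1,\dots,\mathcal S_d)$ be a $d$-tuple of abstract numeration systems $\mathcal S_i=(L_i,A_i,<_i)$. Let $\#$ be a symbol not in $A_1\cup\dots\cup A_d$ and let $\boldsymbol A=\prod_{i=1}^d (A_i\cup\{\#\})\setminus\{(\#,\dots,\#)\}$. For words $w_i\in A_i^*$, let $(w_1,\dots,w_d)^{\#}\in\boldsymbol A^*$ be the word obtained by padding the $w_i$ on the left with $\#$ to their maximal length and reading the $d$ words in parallel. Put $\mathrm{rep}_{\boldsymbol{\mathcal S}}(n_1,\dots,n_d)=(\mathrm{rep}_{\mathcal S_1}(n_1),\dots,\mathrm{rep}_{\mathcal S_d}(n_d))^{\#}$ and $\boldsymbol L=\{(w_1,\dots,w_d)^{\#}\colon w_i\in L_i\}=\mathrm{rep}_{\boldsymbol{\mathcal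 S}}(\mathbb{N}^d)$, and let $\mathrm{val}_{\boldsymbol{\mathcal S}}\colon\boldsymbol L\to\mathbb{N}^d$ be the inverse of $\mathrm{rep}_{\boldsymbol{\mathcal S}}$. A set $X\subseteq\mathbb{N}^d$ is $\boldsymbol{\mathcal S}$-recognizable if the language $\mathrm{rep}_{\boldsymbol{\mathcal S}}(X)$ is regular. Addition is $\boldsymbol{\mathcal S}$-recognizable if the set $\{(\boldsymbol x,\boldsymbol y,\boldsymbol z)\in\mathbb{N}^{3d}\colon \boldsymbol x+\boldsymbol y=\boldsymbol z\}$ is recognizable with respect to the $3d$-dimensional system $(\boldsymbol{\mathcal S},\boldsymbol{\mathcal S},\boldsymbol{\mathcal S})$. A sequence $f\colon\mathbb{N}^d\to\mathbb{K}$, with values in any set $\mathbb K$ (for example a semiring), is $\boldsymbol{\mathcal S}$-automatic if there is a deterministic finite automaton with output which, for every $\boldsymbol n\in\mathbb{N}^d$, outputs $f(\boldsymbol n)$ on reading $\mathrm{rep}_{\boldsymbol{\mathcal S}}(\boldsymbol n)$. A sequence $g\colon\mathbb{N}^d\to\mathbb{N}$ is $(\boldsymbol{\mathcal S},\mathbb{N})$-regular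 if the series $S_g\colon\boldsymbol A^*\to\mathbb{N}$, given by $S_g(\boldsymbol w)=g(\mathrm{val}_{\boldsymbol{\mathcal S}}(\boldsymbol w))$ for $\boldsymbol w\in\boldsymbol L$ and $S_g(\boldsymbol w)=0$ otherwise, is $\mathbb{N}$-recognizable, i.e. there are $r\ge1$, a monoid morphism $\mu\colon\boldsymbol A^*\to\mathbb{N}^{r\times r}$, a row $\lambda\in\mathbb{N}^{1\times r}$ and a column $\gamma\in\mathbb{N}^{r\times1}$ with $S_g(\boldsymbol w)=\lambda\mu(\boldsymbol w)\gamma$ for all $\boldsymbol w\in\boldsymbol A^*$. For $\boldsymbol p,\boldsymbol s\in\mathbb{N}^d$, the factor of $f$ of size $\boldsymbol s$ at position $\boldsymbol p$ is the map $\prod_{i=1}^d\{0,\dots,s_i-1\}\to\mathbb{K}$, $\boldsymbol i\mapsto f(\boldsymbol p+\boldsymbol i)$, and $\rho_f(\boldsymbol s)$ is the number of distinct factors of $f$ of size $\boldsymbol s$. Theorem. Suppose that addition is $\boldsymbol{\mathcal S}$-recognizable and that $f\colon\mathbb{N}^d\to\mathbb{K}$ is $\boldsymbol{\mathcal S}$-automatic.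 Then $\rho_f(\boldsymbol s)$ is finite for every $\boldsymbol s\in\mathbb{N}^d$, and the factor complexity $\rho_f\colon\mathbb{N}^d\to\mathbb{N}$, $\boldsymbol s\mapsto\rho_f(\boldsymbol s)$, is $(\boldsymbol{\mathcal S},\mathbb{N})$-regular. -/

import Mathlib

/-- An abstract numeration system `(L, A, <)`: an infinite regular language `L` over a finite
totally ordered alphabet `(A, <)`. -/
structure AbstractNumerationSystem (A : Type*) [Finite A] [LinearOrder A] where
  /-- The numeration language. -/
  lang : Language A
  regular : lang.IsRegular
  infinite : Set.Infinite {w : List A | w ∈ lang}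

namespace AbstractNumerationSystem

theorem shortlex_trans {A : Type*} [LinearOrder A] {u v w : List A}
    (h₁ : List.Shortlex (fun a b : A => a < b) u v)
    (h₂ : List.Shortlex (fun a b : A => a < b) v w) :
    List.Shortlex (fun a b : A => a < b) u w := by
  rw [List.shortlex_def] at *
  rcases h₁ with h₁ | ⟨h₁, k₁⟩ <;> rcases h₂ with h₂ | ⟨h₂, k₂⟩
  · left; omega
  · left; omega
  · left; omega
  · right
    exact ⟨h₁.trans h₂, List.lex_lt.mpr (lt_trans (List.lex_lt.mp k₁) (List.lex_lt.mp k₂))⟩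

variable {A : Type*} [Finite A] [LinearOrder A]

/-- The words of the numeration language that precede `w` in the radix order. -/
def below (S : AbstractNumerationSystem A) (w : List A) : Set (List A) :=
  {u | u ∈ S.lang ∧ List.Shortlex (fun a b : A => a < b) u w}

/-- The value of a word `w` (meaningful for `w` in the numeration language): the number of words
of the language that precede `w` in the radix order, that is, the index of `w`, counted from `0`,
in the language listed in increasing radix order. -/
noncomputable def val (S : AbstractNumerationSystem A) (w : List A) : ℕ :=
  (S.below w).ncard

theorem finite_below (S : AbstractNumerationSystem A) (w : List A) : (S.below w).Finite := by
  refine (List.finite_length_le A w.length).subset ?_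
  rintro u ⟨-, hu⟩
  rcases List.shortlex_def.mp hu with h | h
  · exact h.le
  · exact h.1.le

theorem val_lt_val (S : AbstractNumerationSystem A) {u w : List A} (hu : u ∈ S.lang)
    (h : List.Shortlex (fun a b : A => a < b) u w) : S.val u < S.val w := by
  refine Set.ncard_lt_ncard ⟨fun v hv => ⟨hv.1, shortlex_trans hv.2 h⟩, fun hs => ?_⟩
    (S.finite_below w)
  have := (hs (show u ∈ S.below w from ⟨hu, h⟩)).2
  exact Std.Asymm.asymm _ _ this this

theorem val_injOn (S : AbstractNumerationSystem A) :
    Set.InjOn S.val {w | w ∈ S.lang} := by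
  intro u hu v hv h
  by_contra hne
  by_cases h₁ : List.Shortlex (fun a b : A => a < b) u v
  · exact (S.val_lt_val hu h₁).ne h
  · by_cases h₂ : List.Shortlex (fun a b : A => a < b) v u
    · exact (S.val_lt_val hv h₂).ne h.symm
    · exact hne (Std.Trichotomous.trichotomous _ _ h₁ h₂)

theorem val_bijective (S : AbstractNumerationSystem A) :
    Function.Bijective (fun w : {w : List A // w ∈ S.lang} => S.val w.1) := by
  refine ⟨fun u v h => Subtype.ext (S.val_injOn u.2 v.2 h), fun n => ?_⟩
  have hinf : (S.val '' {w | w ∈ S.lang}).Infinite := S.infinite.image S.val_injOn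
  obtain ⟨_, ⟨w, hw, rfl⟩, hn⟩ := hinf.exists_gt n
  have himg : S.val '' S.below w = Set.Iio (S.val w) := by
    refine Set.eq_of_subset_of_ncard_le ?_ ?_ (Set.finite_Iio _)
    · rintro _ ⟨u, hu, rfl⟩
      exact S.val_lt_val hu.1 hu.2
    · rw [(S.val_injOn.mono fun u (hu : u ∈ S.below w) => hu.1).ncard_image]
      simp [val]
  obtain ⟨u, hu, rfl⟩ : n ∈ S.val '' S.below w := himg ▸ hn
  exact ⟨⟨u, hu.1⟩, rfl⟩

/-- The representation function: `rep n` is the `n`-th word (counted from `0`) of the numeration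
language in the radix order, i.e. `rep` is the inverse of `val` restricted to the language. -/
noncomputable def rep (S : AbstractNumerationSystem A) (n : ℕ) : List A :=
  ((Equiv.ofBijective _ S.val_bijective).symm n).1

/-- The `d`-dimensional alphabet `((A₁)_# × ⋯ × (A_d)_#) \ {(#, …, #)}`; the padding symbol `#` is
`none`. -/
abbrev Letter {ι : Type*} (A : ι → Type*) : Type _ :=
  {a : ∀ i, Option (A i) // a ≠ fun _ => none}

section Multi

variable {ι : Type*} [Fintype ι]

/-- The maximum of the lengths of the words of a tuple. -/
def maxLength {A : ι → Type*} (w : ∀ i, List (A i)) : ℕ :=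
  Finset.univ.sup fun i => (w i).length

/-- The `i`-th word of a tuple, padded to the left with `#` up to the maximal length. -/
def padRow {A : ι → Type*} (w : ∀ i, List (A i)) (i : ι) : List (Option (A i)) :=
  List.replicate (maxLength w - (w i).length) none ++ (w i).map some

theorem length_padRow {A : ι → Type*} (w : ∀ i, List (A i)) (i : ι) :
    (padRow w i).length = maxLength w := by
  have : (w i).length ≤ maxLength w :=
    Finset.le_sup (f := fun i => (w i).length) (Finset.mem_univ i)
  simp [padRow, this]

theorem padRow_column_ne {A : ι → Type*} (w : ∀ i, List (A i)) (j : Fin (maxLength w)) :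
    (fun i => (padRow w i).get (j.cast (length_padRow w i).symm)) ≠ fun _ => none := by
  intro h
  have hne : (Finset.univ : Finset ι).Nonempty := by
    by_contra hempty
    have h0 : maxLength w = 0 := by
      simp [maxLength, Finset.not_nonempty_iff_eq_empty.mp hempty]
    exact absurd j.2 (by omega)
  obtain ⟨i, -, hi⟩ := Finset.exists_mem_eq_sup Finset.univ hne (fun i => (w i).length)
  have hi' : maxLength w = (w i).length := hi
  have := congrFun h i
  simp [padRow, hi'] at this

/-- The word `(w₁, …, w_d)^#` over the `d`-dimensional alphabet: the words are padded to the left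
to the same length, and the `j`-th letter is the tuple of the `j`-th letters. -/
def pad {A : ι → Type*} (w : ∀ i, List (A i)) : List (Letter A) :=
  List.ofFn fun j : Fin (maxLength w) =>
    ⟨fun i => (padRow w i).get (j.cast (length_padRow w i).symm), padRow_column_ne w j⟩

variable {A : ι → Type*} [∀ i, Finite (A i)] [∀ i, LinearOrder (A i)]

/-- The numeration language `(L₁ × ⋯ × L_d)^#` of the tuple `S = (S₁, …, S_d)`. -/
def multiLang (S : ∀ i, AbstractNumerationSystem (A i)) : Language (Letter A) :=
  {w | ∃ u : ∀ i, List (A i), (∀ i, u i ∈ (S i).lang) ∧ w = pad u}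

/-- The representation of a vector: the padded tuple of the representations. -/
noncomputable def multiRep (S : ∀ i, AbstractNumerationSystem (A i)) (n : ι → ℕ) :
    List (Letter A) :=
  pad fun i => (S i).rep (n i)

/-- The value of a word of the numeration language: component by component, the padding symbols
are erased and the value of the resulting word is taken. -/
noncomputable def multiVal (S : ∀ i, AbstractNumerationSystem (A i)) (w : List (Letter A)) :
    ι → ℕ :=
  fun i => (S i).val (w.map fun a => a.1 i).reduceOption

/-- A set `X` of vectors is `S`-recognizable if the language `rep_S(X)` is regular. -/
def IsRecognizable (S : ∀ i, AbstractNumerationSystem (A i)) (X : Set (ι → ℕ)) : Prop :=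
  Language.IsRegular (multiRep S '' X : Set (List (Letter A)))

/-- The tuple `S^m = (S, …, S)` (`m` times), of dimension `m * d`: its components are indexed by
the pairs of a block `k` and a component `i` of `S`. -/
def power (S : ∀ i, AbstractNumerationSystem (A i)) (m : ℕ) :
    ∀ p : Fin m × ι, AbstractNumerationSystem (A p.2) :=
  fun p => S p.2

/-- An `m * d`-ary predicate, on `m` vectors of dimension `d`, is `S`-recognizable if its
characteristic set is `S^m`-recognizable. -/
def IsRecognizablePred (S : ∀ i, AbstractNumerationSystem (A i)) (m : ℕ)
    (P : (Fin m → ι → ℕ) → Prop) : Prop :=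
  IsRecognizable (power S m) {v | P fun k i => v (k, i)}

/-- Addition is `S`-recognizable: the predicate `x + y = z` on vectors is `S`-recognizable. -/
def AdditionRecognizable (S : ∀ i, AbstractNumerationSystem (A i)) : Prop :=
  IsRecognizablePred S 3 fun x => x 0 + x 1 = x 2

end Multi

end AbstractNumerationSystem

/-- A deterministic automaton with output (finiteness of the set `σ` of states is asked for where
it is used). -/
structure DFAO (α σ K : Type*) where
  /-- The transition function. -/
  step : σ → α → σ
  /-- The initial state. -/
  start : σ
  /-- The output function. -/
  out : σ → K

/-- The output of the automaton after reading the word `w` from left to right. -/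
def DFAO.output {α σ K : Type*} (M : DFAO α σ K) (w : List α) : K :=
  M.out (w.foldl M.step M.start)

/-- A series `s : α* → K` is `K`-recognizable if it has a linear representation `(l, μ, g)` of some
dimension `r ≥ 1`. -/
def IsRecognizableSeries {α K : Type*} [Semiring K] (s : List α → K) : Prop :=
  ∃ r : ℕ, 1 ≤ r ∧ ∃ (l : Matrix (Fin 1) (Fin r) K)
    (μ : FreeMonoid α →* Matrix (Fin r) (Fin r) K) (g : Matrix (Fin r) (Fin 1) K),
    ∀ w : List α, s w = (l * μ (FreeMonoid.ofList w) * g) 0 0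

namespace AbstractNumerationSystem

section Sequences

variable {ι : Type*} [Fintype ι] {A : ι → Type*} [∀ i, Finite (A i)] [∀ i, LinearOrder (A i)]

/-- The sequence `f` is `S`-automatic: some finite automaton with output, on reading `rep_S(n)`,
outputs `f(n)`, for all `n`. -/
def IsAutomatic {K : Type*} (S : ∀ i, AbstractNumerationSystem (A i)) (f : (ι → ℕ) → K) : Prop :=
  ∃ (σ : Type) (_ : Finite σ) (M : DFAO (Letter A) σ K), ∀ n, f n = M.output (multiRep S n)

open Classical in
/-- The series `∑_{w ∈ L} f(val_S(w)) w` of a sequence `f`. -/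
noncomputable def seqSeries {K : Type*} [Semiring K] (S : ∀ i, AbstractNumerationSystem (A i))
    (f : (ι → ℕ) → K) : List (Letter A) → K :=
  fun w => if w ∈ multiLang S then f (multiVal S w) else 0

/-- The sequence `f` is `(S, K)`-regular: its series is `K`-recognizable. -/
def IsRegularSeq {K : Type*} [Semiring K] (S : ∀ i, AbstractNumerationSystem (A i))
    (f : (ι → ℕ) → K) : Prop :=
  IsRecognizableSeries (seqSeries S f)

end Sequences

end AbstractNumerationSystem

/-- The factor `f[p, s]` of size `s` occurring at position `p` in `f`, a map on the box
`[0, s₁ - 1] × ⋯ × [0, s_d - 1]`. -/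
def factorAt {ι K : Type*} (f : (ι → ℕ) → K) (p s : ι → ℕ) : (∀ i, Fin (s i)) → K :=
  fun j => f fun i => p i + j i

/-- The factor complexity: `factorComplexity f s` is the number, possibly infinite, of factors of
size `s` occurring in `f`. -/
noncomputable def factorComplexity {ι K : Type*} (f : (ι → ℕ) → K) (s : ι → ℕ) : ℕ∞ :=
  (Set.range fun p : ι → ℕ => factorAt f p s).encard

/-! Each factor of size `s` has a unique lexicographically first occurrence `p`, so the complexity
at `s` is the number of pairs `(s, p)` in a single set. That set is first-order definable from
addition and from equality of values of `f`: the order on each component is a projection of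
addition, and a factor is compared pointwise. Regular predicates are closed under Boolean
combinations, reindexing and projection, so the set has a regular language. Counting the accepted
words that project to a given representation of `s` then yields an ℕ-linear representation
(`isRegularSeq_ncard`).

The technical obstacle is padding. Forgetting rows can leave leading columns `(#, …, #)`, which are
not letters. The closure properties are therefore proved for `paddedLang`, where any amount of
leading padding is allowed and membership is a condition on each row. The counts stay finite because
`f` factors through finitely many states, so there are finitely many factors of each size. -/

namespace Language

/-! ### Closure properties of regular languages -/

variable {α β : Type*}

theorem IsRegular.congr {L L' : Language α} (h : L.IsRegular) (e : ∀ w, w ∈ L' ↔ w ∈ L) :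
    L'.IsRegular :=
  (Set.ext e : L' = L) ▸ h

/-- Any Boolean combination of finitely many regular languages is regular. -/
theorem isRegular_setOf {κ : Type} [Finite κ] {L : κ → Language α} (h : ∀ k, (L k).IsRegular)
    (P : (κ → Prop) → Prop) : Language.IsRegular {w | P fun k => w ∈ L k} := by
  choose σ hσ M hM using h
  have := Fintype.ofFinite κ
  have hfin : Finite (∀ k, σ k) := inferInstance
  refine ⟨∀ k, σ k, Fintype.ofFinite _,
    ⟨fun s a k => (M k).step (s k) a, fun k => (M k).start, {s | P fun k => s k ∈ (M k).accept}⟩, ?_⟩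
  have key : ∀ (w : List α) (s : ∀ k, σ k),
      w.foldl (fun (s : ∀ k, σ k) a k => (M k).step (s k) a) s = fun k => (M k).evalFrom (s k) w := by
    intro w
    induction w with
    | nil => intro s; rfl
    | cons a w ih => intro s; simp [ih]
  ext w
  have : ∀ k, w ∈ L k ↔ (M k).eval w ∈ (M k).accept := fun k => by rw [← hM k]; rfl
  change P (fun k => _ ∈ _) ↔ P _
  rw [DFA.evalFrom, key]
  simp only [this]
  rfl

theorem IsRegular.preimage_map {L : Language β} (h : L.IsRegular) (f : α → β) :
    Language.IsRegular {w : List α | w.map f ∈ L} := by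
  obtain ⟨σ, _, M, rfl⟩ := h
  exact ⟨σ, inferInstance, M.comap f, M.accepts_comap f⟩

theorem IsRegular.preimage_filterMap {L : Language β} (h : L.IsRegular) (f : α → Option β) :
    Language.IsRegular {w : List α | w.filterMap f ∈ L} := by
  obtain ⟨σ, _, M, rfl⟩ := h
  refine ⟨σ, inferInstance, ⟨fun s a => (f a).elim s (M.step s), M.start, M.accept⟩, ?_⟩
  ext w
  change w.foldl (fun s a => (f a).elim s (M.step s)) M.start ∈ M.accept ↔
    (w.filterMap f).foldl M.step M.start ∈ M.accept
  rw [List.foldl_filterMap]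
  congr! 3 with s
  funext a
  cases f a <;> rfl

/-- The image of a regular language under a letter-to-letter map, up to the deletion of leading
occurrences of a letter `c`, is regular. -/
theorem IsRegular.map_deleteLeading {L : Language α} (h : L.IsRegular) (f : α → β) (c : β) :
    Language.IsRegular {w : List β | ∃ k, ∃ v ∈ L, v.map f = List.replicate k c ++ w} := by
  obtain ⟨σ, _, M, rfl⟩ := h
  -- The deleted prefix is absorbed by the initial states: these are all states that `M` reaches on
  -- words mapped to powers of `c`.
  let N : NFA β σ :=
    ⟨fun s b => {t | ∃ a, f a = b ∧ M.step s a = t},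
      {s | ∃ k u, u.map f = List.replicate k c ∧ M.eval u = s}, M.accept⟩
  have key : ∀ (w : List β) (T : Set σ) (t : σ),
      t ∈ N.evalFrom T w ↔ ∃ s ∈ T, ∃ v, v.map f = w ∧ M.evalFrom s v = t := by
    intro w
    induction w with
    | nil => intro T t; simp
    | cons b w ih =>
      intro T t
      rw [NFA.evalFrom_cons, ih]
      constructor
      · rintro ⟨s, hs, v, rfl, rfl⟩
        obtain ⟨s', hs', a, rfl, rfl⟩ := NFA.mem_stepSet.mp hs
        exact ⟨s', hs', a :: v, by simp, rfl⟩
      · rintro ⟨s, hs, v, hv, rfl⟩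
        obtain ⟨a, v, rfl, rfl, rfl⟩ := List.map_eq_cons_iff.mp hv
        exact ⟨_, NFA.mem_stepSet.mpr ⟨s, hs, a, rfl, rfl⟩, v, rfl, rfl⟩
  refine ⟨Set σ, Fintype.ofFinite _, N.toDFA, ?_⟩
  rw [NFA.toDFA_correct]
  ext w
  rw [NFA.mem_accepts]
  simp only [key]
  constructor
  · rintro ⟨_, ht, _, ⟨k, u, hu, rfl⟩, v, hv, rfl⟩
    refine ⟨k, u ++ v, ?_, by simp [hu, hv]⟩
    rwa [DFA.mem_accepts, DFA.eval, DFA.evalFrom_of_append]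
  · rintro ⟨k, v, hv, hvw⟩
    obtain ⟨u, v, rfl, hu, hv'⟩ := List.map_eq_append_iff.mp hvw
    rw [DFA.mem_accepts, DFA.eval, DFA.evalFrom_of_append] at hv
    exact ⟨_, hv, _, ⟨k, u, hu, rfl⟩, v, hv', rfl⟩

/-- The words `none ⋯ none some a₁ ⋯ some aₙ` with `a₁ ⋯ aₙ` in a regular language form a regular
language. -/
theorem IsRegular.padded {L : Language α} (h : L.IsRegular) :
    Language.IsRegular
      {w : List (Option α) | ∃ k, ∃ u ∈ L, w = List.replicate k none ++ u.map some} := by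
  obtain ⟨σ, _, M, rfl⟩ := h
  -- `none` is a dead state, `some none` means that only padding has been read, and `some (some s)`
  -- that `M` is in state `s`. The second state accepts exactly when the empty word is in the
  -- language.
  let N : DFA (Option α) (Option (Option σ)) :=
    ⟨fun s a => match s, a with
      | none, _ => none
      | some none, none => some none
      | some none, some a => some (some (M.step M.start a))
      | some (some _), none => none
      | some (some s), some a => some (some (M.step s a)),
     some none, {s | s = some none ∧ M.start ∈ M.accept ∨ ∃ t ∈ M.accept, s = some (some t)}⟩
  have dead : ∀ w : List (Option α), N.evalFrom none w = none := by
    intro w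
    induction w with
    | nil => rfl
    | cons a w ih => exact ih
  have late : ∀ (w : List (Option α)) (s : σ),
      N.evalFrom (some (some s)) w ∈ N.accept ↔ ∃ u, M.evalFrom s u ∈ M.accept ∧ w = u.map some := by
    intro w
    induction w with
    | nil => intro s; simp [N]
    | cons a w ih =>
      intro s
      cases a with
      | none =>
        change N.evalFrom none w ∈ N.accept ↔ _
        rw [dead]
        simp only [N, Set.mem_ofPred_eq, reduceCtorEq, false_and, and_false, exists_false, or_self,
          false_iff]
        rintro ⟨_ | ⟨b, u⟩, -, hu⟩ <;> simp at hu
      | some a =>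
        change N.evalFrom (some (some (M.step s a))) w ∈ N.accept ↔ _
        rw [ih]
        constructor
        · rintro ⟨u, hu, rfl⟩
          exact ⟨a :: u, hu, rfl⟩
        · rintro ⟨_ | ⟨b, u⟩, hu, he⟩
          · simp at he
          · simp only [List.map_cons, List.cons.injEq, Option.some.injEq] at he
            obtain ⟨rfl, rfl⟩ := he
            exact ⟨u, hu, rfl⟩
  refine ⟨_, inferInstance, N, ?_⟩
  ext w
  change N.evalFrom (some none) w ∈ N.accept ↔ ∃ k, ∃ u ∈ M.accepts, _
  induction w with
  | nil =>
    simp only [N, DFA.evalFrom_nil, Set.mem_ofPred_eq]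
    constructor
    · rintro (⟨-, h⟩ | ⟨t, -, h⟩)
      · exact ⟨0, [], h, rfl⟩
      · simp at h
    · rintro ⟨k, u, hu, he⟩
      obtain ⟨-, rfl⟩ : _ ∧ u = [] := by simpa using he.symm
      exact Or.inl ⟨by trivial, hu⟩
  | cons a w ih =>
    cases a with
    | none =>
      change N.evalFrom (some none) w ∈ N.accept ↔ _
      rw [ih]
      constructor
      · rintro ⟨k, u, hu, rfl⟩
        exact ⟨k + 1, u, hu, rfl⟩
      · rintro ⟨_ | k, u, hu, he⟩
        · cases u <;> simp at he
        · exact ⟨k, u, hu, by simpa [List.replicate_succ] using he⟩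
    | some a =>
      change N.evalFrom (some (some _)) w ∈ N.accept ↔ _
      rw [late]
      constructor
      · rintro ⟨u, hu, rfl⟩
        exact ⟨0, a :: u, hu, rfl⟩
      · rintro ⟨_ | k, u, hu, he⟩
        · cases u with
          | nil => simp at he
          | cons b u =>
            simp only [List.replicate_zero, List.nil_append, List.map_cons, List.cons.injEq,
              Option.some.injEq] at he
            obtain ⟨rfl, rfl⟩ := he
            exact ⟨u, hu, rfl⟩
        · simp [List.replicate_succ] at he

end Language

/-! ### Recognizable series obtained by counting words -/

/-- A linear representation indexed by an arbitrary nonempty finite set of states, given by the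
recursion that its vectors of right values satisfy. -/
theorem IsRecognizableSeries.of_recursion {α σ K : Type*} [Semiring K] [Fintype σ] [Nonempty σ]
    {s : List α → K} (l g : σ → K) (μ : α → σ → σ → K) (N : σ → List α → K)
    (hnil : ∀ q, N q [] = g q) (hcons : ∀ q a w, N q (a :: w) = ∑ q', μ a q q' * N q' w)
    (hs : ∀ w, s w = ∑ q, l q * N q w) : IsRecognizableSeries s := by
  let e := Fintype.equivFin σ
  let m : FreeMonoid α →* Matrix (Fin (Fintype.card σ)) (Fin (Fintype.card σ)) K :=
    FreeMonoid.lift fun a => Matrix.of fun i j => μ a (e.symm i) (e.symm j)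
  let c : Matrix (Fin (Fintype.card σ)) (Fin 1) K := Matrix.of fun i _ => g (e.symm i)
  have key : ∀ (w : List α) (i : Fin (Fintype.card σ)),
      (m (FreeMonoid.ofList w) * c) i 0 = N (e.symm i) w := by
    intro w
    induction w with
    | nil =>
      intro i
      rw [hnil, FreeMonoid.ofList_nil, map_one, Matrix.one_mul]
      rfl
    | cons a w ih =>
      intro i
      rw [hcons, FreeMonoid.ofList_cons, map_mul, Matrix.mul_assoc, Matrix.mul_apply,
        ← e.symm.sum_comp]
      refine Finset.sum_congr rfl fun j _ => ?_
      rw [ih]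
      simp [m]
  refine ⟨Fintype.card σ, Fintype.card_pos, Matrix.of fun _ i => l (e.symm i), m, c, fun w => ?_⟩
  rw [hs, Matrix.mul_assoc, Matrix.mul_apply, ← e.symm.sum_comp]
  exact Finset.sum_congr rfl fun i _ => by rw [key]; rfl

/-- The number of words of a regular language that a letter-to-letter map sends to a given word, up
to leading deleted letters, is a recognizable series as soon as it is finite. -/
theorem Language.IsRegular.isRecognizableSeries_ncard {α β : Type*} [Finite α] {L : Language α}
    (h : L.IsRegular) (f : α → Option β)
    (hfin : ∀ w : List β,
      {v | v ∈ L ∧ ∃ k, v.map f = List.replicate k none ++ w.map some}.Finite) :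
    IsRecognizableSeries fun w : List β =>
      {v | v ∈ L ∧ ∃ k, v.map f = List.replicate k none ++ w.map some}.ncard := by
  obtain ⟨σ, _, M, rfl⟩ := h
  have : Nonempty σ := ⟨M.start⟩
  have hlen : ∀ (w : List β) (q : σ),
      Finite {t : List α // t.map f = w.map some ∧ M.evalFrom q t ∈ M.accept} := by
    intro w q
    refine ((List.finite_length_eq α w.length).subset ?_).to_subtype
    rintro t ⟨ht, -⟩
    simpa using congrArg List.length ht
  -- A counted word splits uniquely as `u ++ t` with `t` of the length of `w`. The row `l` counts
  -- the deleted prefixes `u` by the state reached, `μ` counts letters, and `N` counts the accepted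
  -- continuations `t`.
  refine IsRecognizableSeries.of_recursion
    (l := fun q => Nat.card {u : List α // (∃ k, u.map f = List.replicate k none) ∧ M.eval u = q})
    (μ := fun b q q' => Nat.card {a : α // f a = some b ∧ M.step q a = q'})
    (N := fun q w => Nat.card
      {t : List α // t.map f = w.map some ∧ M.evalFrom q t ∈ M.accept})
    (g := _) (fun _ => rfl) ?_ ?_
  · intro q b w
    simp only [← Nat.card_prod]
    rw [← Nat.card_sigma]
    let F : (Σ q' : σ, {a : α // f a = some b ∧ M.step q a = q'} ×
        {t : List α // t.map f = w.map some ∧ M.evalFrom q' t ∈ M.accept}) →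
        {t : List α // t.map f = (b :: w).map some ∧ M.evalFrom q t ∈ M.accept} :=
      fun x => ⟨x.2.1.1 :: x.2.2.1, by simp [x.2.1.2.1, x.2.2.2.1], by
        rw [DFA.evalFrom_cons, x.2.1.2.2]
        exact x.2.2.2.2⟩
    refine (Nat.card_congr (Equiv.ofBijective F ⟨?_, ?_⟩)).symm
    · rintro ⟨_, ⟨a, ha, rfl⟩, ⟨t, ht⟩⟩ ⟨_, ⟨a', ha', rfl⟩, ⟨t', ht'⟩⟩ he
      obtain ⟨rfl, rfl⟩ := List.cons_eq_cons.mp (congrArg Subtype.val he)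
      rfl
    · rintro ⟨t, ht, hq⟩
      obtain ⟨a, t, rfl, ha, ht⟩ := List.map_eq_cons_iff.mp ht
      exact ⟨⟨_, ⟨a, ha, rfl⟩, ⟨t, ht, hq⟩⟩, rfl⟩
  · intro w
    let F : (Σ q : σ, {u : List α // (∃ k, u.map f = List.replicate k none) ∧ M.eval u = q} ×
        {t : List α // t.map f = w.map some ∧ M.evalFrom q t ∈ M.accept}) →
        {v // v ∈ M.accepts ∧ ∃ k, v.map f = List.replicate k none ++ w.map some} :=
      fun x => ⟨x.2.1.1 ++ x.2.2.1, by
        change M.evalFrom M.start _ ∈ M.accept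
        rw [DFA.evalFrom_of_append]
        change M.evalFrom (M.eval x.2.1.1) _ ∈ M.accept
        rw [x.2.1.2.2]
        exact x.2.2.2.2, by
        obtain ⟨k, hk⟩ := x.2.1.2.1
        exact ⟨k, by rw [List.map_append, hk, x.2.2.2.1]⟩⟩
    have hF : Function.Bijective F := by
      constructor
      · rintro ⟨_, ⟨u, hu, rfl⟩, ⟨t, ht⟩⟩ ⟨_, ⟨u', hu', rfl⟩, ⟨t', ht'⟩⟩ he
        have hl : t.length = t'.length := by
          simpa using congrArg List.length (ht.1.trans ht'.1.symm)
        obtain ⟨rfl, rfl⟩ := List.append_inj' (congrArg Subtype.val he) hl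
        rfl
      · rintro ⟨v, hv, k, hk⟩
        obtain ⟨u, t, rfl, hu, ht⟩ := List.map_eq_append_iff.mp hk
        rw [DFA.mem_accepts, DFA.eval, DFA.evalFrom_of_append] at hv
        exact ⟨⟨_, ⟨u, ⟨k, hu⟩, rfl⟩, ⟨t, ht, hv⟩⟩, rfl⟩
    have : Finite {v // v ∈ M.accepts ∧ ∃ k, v.map f = List.replicate k none ++ w.map some} :=
      (hfin w).to_subtype
    have hsig := Finite.of_injective F hF.1
    -- Infinitely many prefixes may reach `q`, and `Nat.card` is then 0. This is harmless: the
    -- product being finite, no continuation from `q` exists in that case.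
    have : ∀ q : σ, Finite ({u : List α // (∃ k, u.map f = List.replicate k none) ∧ M.eval u = q} ×
        {t : List α // t.map f = w.map some ∧ M.evalFrom q t ∈ M.accept}) := fun q =>
      @Finite.of_injective _ _ hsig (fun x => ⟨q, x⟩) fun x y h =>
        eq_of_heq (Sigma.mk.inj h).2
    simp only [← Nat.card_prod]
    rw [← Nat.card_sigma]
    exact (Nat.card_congr (Equiv.ofBijective F hF)).symm

/-! ### Padded representations of vectors -/

namespace AbstractNumerationSystem

section Rep

variable {A : Type*} [Finite A] [LinearOrder A] (S : AbstractNumerationSystem A)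

theorem rep_mem (n : ℕ) : S.rep n ∈ S.lang :=
  ((Equiv.ofBijective _ S.val_bijective).symm n).2

theorem val_rep (n : ℕ) : S.val (S.rep n) = n :=
  (Equiv.ofBijective _ S.val_bijective).apply_symm_apply n

theorem rep_val {w : List A} (hw : w ∈ S.lang) : S.rep (S.val w) = w :=
  S.val_injOn (S.rep_mem _) hw (S.val_rep _)

theorem rep_injective : Function.Injective S.rep :=
  Function.LeftInverse.injective S.val_rep

end Rep

section Padding

theorem replicate_none_append_map_some_injective {A : Type*} {k l : ℕ} {u v : List A}
    (h : List.replicate k none ++ u.map some = List.replicate l none ++ v.map some) : u = v := by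
  have := congrArg List.reduceOption h
  simpa [List.reduceOption_append, List.reduceOption_replicate_none, List.reduceOption] using this

theorem exists_eq_replicate_none_of_append {A : Type*} {u : List A} :
    ∀ {k l : ℕ} {c : List (Option A)},
      List.replicate k none ++ c = List.replicate l none ++ u.map some →
      ∃ m, c = List.replicate m none ++ u.map some
  | 0, l, _, h => ⟨l, h⟩
  | k + 1, 0, c, h => by cases u <;> simp [List.replicate_succ] at h
  | k + 1, l + 1, c, h => by
    simp only [List.replicate_succ, List.cons_append, List.cons.injEq, true_and] at h
    exact exists_eq_replicate_none_of_append h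

theorem eq_of_map_apply_eq {J : Type*} {B : J → Type*} :
    ∀ {w v : List (∀ j, B j)}, w.length = v.length →
      (∀ j, w.map (fun b => b j) = v.map fun b => b j) → w = v
  | [], [], _, _ => rfl
  | a :: w, b :: v, hl, h => by
    have h' := fun j => List.cons_eq_cons.mp (h j)
    exact List.cons_eq_cons.mpr ⟨funext fun j => (h' j).1,
      eq_of_map_apply_eq (Nat.succ.inj hl) fun j => (h' j).2⟩

variable {J : Type*} {A : J → Type*}

open Classical in
/-- The letter of the alphabet of the system given by a tuple, if any. -/
noncomputable def toLetter (b : ∀ j, Option (A j)) : Option (Letter A) :=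
  if h : b ≠ fun _ => none then some ⟨b, h⟩ else none

theorem toLetter_none : toLetter (fun j => (none : Option (A j))) = none := by
  simp [toLetter]

theorem toLetter_val (a : Letter A) : toLetter a.1 = some a := by
  simp [toLetter, a.2]

variable [Fintype J]

theorem length_pad (u : ∀ j, List (A j)) : (pad u).length = maxLength u := by
  simp [pad]

theorem length_le_maxLength (u : ∀ j, List (A j)) (j : J) : (u j).length ≤ maxLength u :=
  Finset.le_sup (f := fun j => (u j).length) (Finset.mem_univ j)

theorem map_pad_apply (u : ∀ j, List (A j)) (j : J) :
    ((pad u).map Subtype.val).map (fun b => b j) = padRow u j := by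
  refine List.ext_getElem (by simp [length_pad, length_padRow]) fun n h₁ h₂ => ?_
  simp [pad]

theorem multiRep_injective [∀ j, Finite (A j)] [∀ j, LinearOrder (A j)]
    (S : ∀ j, AbstractNumerationSystem (A j)) : Function.Injective (multiRep S) := by
  intro x y h
  funext j
  refine (S j).rep_injective ?_
  have := congrArg (fun v => (v.map Subtype.val).map (fun b => b j)) h
  simp only [multiRep, map_pad_apply] at this
  exact replicate_none_append_map_some_injective this

end Padding

section PaddedLang

variable {J : Type} {A : J → Type*} [∀ j, Finite (A j)] [∀ j, LinearOrder (A j)]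
  (S : ∀ j, AbstractNumerationSystem (A j))

/-- The words all of whose rows are representations, padded with arbitrarily many symbols `#`, of the
components of an element of `X`. -/
def paddedLang (X : Set (J → ℕ)) : Language (∀ j, Option (A j)) :=
  {w | ∃ x ∈ X, ∀ j, ∃ k,
    w.map (fun b => b j) = List.replicate k none ++ ((S j).rep (x j)).map some}

theorem mem_paddedLang {X : Set (J → ℕ)} {w : List (∀ j, Option (A j))} :
    w ∈ paddedLang S X ↔ ∃ x ∈ X, ∀ j, ∃ k,
      w.map (fun b => b j) = List.replicate k none ++ ((S j).rep (x j)).map some :=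
  Iff.rfl

variable {S} in
-- Erasing the padding of a row recovers the representation. Hence Boolean operations on sets of
-- vectors match those on padded words.
theorem eq_of_padded {x y : J → ℕ} {w : List (∀ j, Option (A j))}
    (hx : ∀ j, ∃ k, w.map (fun b => b j) = List.replicate k none ++ ((S j).rep (x j)).map some)
    (hy : ∀ j, ∃ k, w.map (fun b => b j) = List.replicate k none ++ ((S j).rep (y j)).map some) :
    x = y := by
  funext j
  obtain ⟨k, hk⟩ := hx j
  obtain ⟨l, hl⟩ := hy j
  exact (S j).rep_injective (replicate_none_append_map_some_injective (hk.symm.trans hl))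

/-- Deleting leading columns that are blank in every selected row only shortens the padding of these
rows. -/
theorem map_mem_paddedLang {J' : Type} (e : J' → J) {X : Set (J → ℕ)} {k : ℕ} {w : List (∀ j', Option (A (e j')))}
    {v : List (∀ j, Option (A j))} (hv : v ∈ paddedLang S X)
    (h : v.map (fun b j' => b (e j')) = List.replicate k (fun _ => none) ++ w) :
    w ∈ paddedLang (fun j' => S (e j')) ((fun x j' => x (e j')) '' X) := by
  obtain ⟨x, hX, hx⟩ := hv
  refine ⟨_, ⟨x, hX, rfl⟩, fun j' => ?_⟩
  obtain ⟨l, hl⟩ := hx (e j')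
  have := congrArg (List.map fun b => b j') h
  rw [List.map_map, List.map_append, List.map_replicate] at this
  exact exists_eq_replicate_none_of_append (this.symm.trans hl)

variable [Fintype J]

/-- The padded words are the words `(w₁, …, w_d)^#` preceded by letters `(#, …, #)`. -/
theorem mem_paddedLang_iff {X : Set (J → ℕ)} {w : List (∀ j, Option (A j))} :
    w ∈ paddedLang S X ↔ ∃ x ∈ X, ∃ k,
      w = List.replicate k (fun _ => none) ++ (multiRep S x).map Subtype.val := by
  rw [mem_paddedLang]
  refine exists_congr fun x => and_congr_right fun _ => ⟨fun h => ?_, ?_⟩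
  · have hle : maxLength (fun j => (S j).rep (x j)) ≤ w.length := by
      refine Finset.sup_le fun j _ => ?_
      obtain ⟨k, hk⟩ := h j
      have := congrArg List.length hk
      simp at this
      beta_reduce
      omega
    refine ⟨w.length - maxLength (fun j => (S j).rep (x j)), eq_of_map_apply_eq ?_ fun j => ?_⟩
    · simp [multiRep, length_pad, hle]
    · obtain ⟨k, hk⟩ := h j
      have hl := congrArg List.length hk
      have : ((S j).rep (x j)).length ≤ maxLength fun j => (S j).rep (x j) :=
        length_le_maxLength (fun j => (S j).rep (x j)) j
      simp only [List.length_map, List.length_append, List.length_replicate] at hl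
      rw [hk, multiRep, List.map_append, map_pad_apply, padRow, List.map_replicate,
        ← List.append_assoc, List.replicate_append_replicate]
      congr 2
      omega
  · rintro ⟨k, rfl⟩ j
    exact ⟨k + (maxLength (fun j => (S j).rep (x j)) - ((S j).rep (x j)).length), by
      rw [multiRep, List.map_append, map_pad_apply, padRow, List.map_replicate,
        ← List.append_assoc, List.replicate_append_replicate]⟩

/-- The rows are constrained independently, each by the regular language of its own system. -/
theorem isRegular_paddedLang_univ : (paddedLang S Set.univ).IsRegular := by
  have h := Language.isRegular_setOf
    (fun j => ((S j).regular.padded).preimage_map fun b : ∀ j, Option (A j) => b j)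
    (fun p => ∀ j, p j)
  refine h.congr fun w => ?_
  rw [mem_paddedLang]
  change _ ↔ ∀ j, ∃ k, ∃ u ∈ (S j).lang, w.map (fun b => b j) = List.replicate k none ++ u.map some
  constructor
  · rintro ⟨x, -, h⟩ j
    obtain ⟨k, hk⟩ := h j
    exact ⟨k, _, (S j).rep_mem _, hk⟩
  · intro h
    choose k u hu hk using h
    exact ⟨fun j => (S j).val (u j), trivial, fun j => ⟨k j, by rw [hk, (S j).rep_val (hu j)]⟩⟩

/-- Boolean combinations of sets with regular languages of padded words. -/
theorem isRegular_paddedLang_setOf {κ : Type} [Finite κ] {X : κ → Set (J → ℕ)}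
    (h : ∀ k, (paddedLang S (X k)).IsRegular) (P : (κ → Prop) → Prop) :
    (paddedLang S {x | P fun k => x ∈ X k}).IsRegular := by
  have hr := (isRegular_paddedLang_univ S).inf (Language.isRegular_setOf h P)
  have key : ∀ (w : List (∀ j, Option (A j))) (x : J → ℕ),
      (∀ j, ∃ k, w.map (fun b => b j) = List.replicate k none ++ ((S j).rep (x j)).map some) →
      ((fun k => x ∈ X k) = fun k => w ∈ paddedLang S (X k)) := by
    intro w x hx
    funext k
    refine propext ⟨fun hk => ⟨x, hk, hx⟩, ?_⟩
    rintro ⟨y, hy, hy'⟩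
    rwa [eq_of_padded hx hy']
  refine hr.congr fun w => ?_
  constructor
  · rintro ⟨x, hP, hx⟩
    refine ⟨⟨x, trivial, hx⟩, ?_⟩
    change P _ at hP
    rwa [key w x hx] at hP
  · rintro ⟨⟨x, -, hx⟩, hP⟩
    refine ⟨x, ?_, hx⟩
    change P _
    rw [key w x hx]
    exact hP

variable {J' : Type} (e : J' → J)

/-- Inverse images under a reindexing of the components. -/
theorem isRegular_paddedLang_preimage {X : Set (J' → ℕ)}
    (h : (paddedLang (fun j' => S (e j')) X).IsRegular) :
    (paddedLang S {x | (fun j' => x (e j')) ∈ X}).IsRegular := by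
  have hr := (isRegular_paddedLang_univ S).inf
    (h.preimage_map fun (b : ∀ j, Option (A j)) j' => b (e j'))
  refine hr.congr fun w => ?_
  constructor
  · rintro ⟨x, hX, hx⟩
    refine ⟨⟨x, trivial, hx⟩, _, hX, fun j' => ?_⟩
    rw [List.map_map]
    exact hx (e j')
  · rintro ⟨⟨x, -, hx⟩, y, hy, hy'⟩
    refine ⟨x, ?_, hx⟩
    have : (fun j' => x (e j')) = y := by
      refine eq_of_padded (S := fun j' => S (e j')) (fun j' => ?_) hy'
      rw [List.map_map]
      exact hx (e j')
    change (fun j' => x (e j')) ∈ X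
    rwa [this]

variable [Fintype J'] in
/-- Direct images under a reindexing of the components. -/
theorem isRegular_paddedLang_image {X : Set (J → ℕ)} (h : (paddedLang S X).IsRegular) :
    (paddedLang (fun j' => S (e j')) ((fun x j' => x (e j')) '' X)).IsRegular := by
  have hr := h.map_deleteLeading (fun (b : ∀ j, Option (A j)) j' => b (e j')) fun _ => none
  refine hr.congr fun w => ?_
  constructor
  · intro hw
    obtain ⟨_, ⟨x, hX, rfl⟩, k, rfl⟩ := (mem_paddedLang_iff _).mp hw
    -- This much padding makes the projected word at least as long as the given one, so that `k ≤ l`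
    -- and the surplus `l - k` blank columns can be deleted.
    have hv : List.replicate (k + (multiRep (fun j' => S (e j')) fun j' => x (e j')).length)
        (fun _ => none) ++ (multiRep S x).map Subtype.val ∈ paddedLang S {x} :=
      (mem_paddedLang_iff S).mpr ⟨x, rfl, _, rfl⟩
    have hm := map_mem_paddedLang S e (k := 0) hv rfl
    obtain ⟨_, ⟨x', hx', rfl⟩, l, hl⟩ := (mem_paddedLang_iff _).mp hm
    rw [Set.mem_singleton_iff.mp hx'] at hl
    have hlen := congrArg List.length hl
    simp only [List.length_map, List.length_append, List.length_replicate] at hlen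
    refine ⟨l - k, _, (mem_paddedLang_iff S).mpr ⟨x, hX, _, rfl⟩, hl.trans ?_⟩
    rw [← List.append_assoc, List.replicate_append_replicate, Nat.sub_add_cancel (by omega)]
  · rintro ⟨k, v, hv, h⟩
    exact map_mem_paddedLang S e hv h

/-- The all-blank column is not a letter, which excludes superfluous padding. This is the way back
from padded words to the numeration alphabet. -/
theorem map_val_mem_paddedLang_iff {X : Set (J → ℕ)} {v : List (Letter A)} :
    v.map Subtype.val ∈ paddedLang S X ↔ v ∈ multiRep S '' X := by
  rw [mem_paddedLang_iff]
  constructor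
  · rintro ⟨x, hx, _ | k, h⟩
    · exact ⟨x, hx, (List.map_injective_iff.mpr Subtype.val_injective h).symm⟩
    · obtain ⟨a, v, rfl, ha, -⟩ := List.map_eq_cons_iff.mp h
      exact absurd ha a.2
  · rintro ⟨x, hx, rfl⟩
    exact ⟨x, hx, 0, rfl⟩

/-- Filtering by `toLetter` erases exactly the superfluous blank columns. -/
theorem isRegular_paddedLang_of_multiRep {L : Language (Letter A)} (h : L.IsRegular) :
    (paddedLang S {x | multiRep S x ∈ L}).IsRegular := by
  have hr := (isRegular_paddedLang_univ S).inf (h.preimage_filterMap toLetter)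
  have key : ∀ (k : ℕ) (v : List (Letter A)),
      (List.replicate k (fun _ => none) ++ v.map Subtype.val).filterMap toLetter = v := by
    intro k v
    rw [List.filterMap_append, List.filterMap_replicate_of_none toLetter_none, List.nil_append,
      List.filterMap_map]
    exact (List.filterMap_congr fun a _ => toLetter_val a).trans List.filterMap_some
  refine hr.congr fun w => ?_
  constructor
  · intro hw
    obtain ⟨x, hx, k, rfl⟩ := (mem_paddedLang_iff S).mp hw
    refine ⟨(mem_paddedLang_iff S).mpr ⟨x, trivial, k, rfl⟩, ?_⟩
    change List.filterMap _ _ ∈ L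
    rw [key]
    exact hx
  · rintro ⟨hw, hL⟩
    obtain ⟨x, -, k, rfl⟩ := (mem_paddedLang_iff S).mp hw
    change List.filterMap _ _ ∈ L at hL
    rw [key] at hL
    exact (mem_paddedLang_iff S).mpr ⟨x, hL, k, rfl⟩

theorem IsRecognizable.isRegular_paddedLang {X : Set (J → ℕ)} (h : IsRecognizable S X) :
    (paddedLang S X).IsRegular := by
  have := isRegular_paddedLang_of_multiRep S h
  convert this using 2
  ext x
  exact ((multiRep_injective S).mem_set_image).symm

end PaddedLang

end AbstractNumerationSystem

/-! ### First-order definability of regular predicates -/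

namespace AbstractNumerationSystem

section Predicates

variable {ι : Type} [Fintype ι] {A : ι → Type*} [∀ i, Finite (A i)] [∀ i, LinearOrder (A i)]
  (S : ∀ i, AbstractNumerationSystem (A i)) {V : Type} [Fintype V]

/-- A predicate on families of vectors, indexed by a finite set `V` of variables, is regular if the
language of padded words of its characteristic set is regular. -/
def IsRegularPred (P : (V → ι → ℕ) → Prop) : Prop :=
  (paddedLang (fun p : V × ι => S p.2) {v | P fun a i => v (a, i)}).IsRegular

namespace IsRegularPred

variable {S}

theorem bool {κ : Type} [Finite κ] {P : κ → (V → ι → ℕ) → Prop} (h : ∀ k, IsRegularPred S (P k))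
    (B : (κ → Prop) → Prop) : IsRegularPred S fun x => B fun k => P k x :=
  isRegular_paddedLang_setOf _ h B

theorem not {P : (V → ι → ℕ) → Prop} (h : IsRegularPred S P) : IsRegularPred S fun x => ¬ P x :=
  bool (κ := Unit) (fun _ => h) fun p => ¬ p ()

theorem and {P Q : (V → ι → ℕ) → Prop} (h : IsRegularPred S P) (h' : IsRegularPred S Q) :
    IsRegularPred S fun x => P x ∧ Q x :=
  bool (κ := Bool) (P := fun b => bif b then P else Q) (fun b => by cases b <;> assumption)
    fun p => p true ∧ p false

theorem imp {P Q : (V → ι → ℕ) → Prop} (h : IsRegularPred S P) (h' : IsRegularPred S Q) :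
    IsRegularPred S fun x => P x → Q x :=
  bool (κ := Bool) (P := fun b => bif b then P else Q) (fun b => by cases b <;> assumption)
    fun p => p true → p false

theorem comp {V' : Type} [Fintype V'] {P : (V' → ι → ℕ) → Prop} (h : IsRegularPred S P)
    (e : V' → V) : IsRegularPred S fun x : V → ι → ℕ => P fun a => x (e a) :=
  isRegular_paddedLang_preimage (fun p : V × ι => S p.2) (fun p : V' × ι => (e p.1, p.2)) h

/-- The bound variable is the extra index `none`; quantifying over it amounts to forgetting its
rows. -/
theorem exists_vec {P : (V → ι → ℕ) → (ι → ℕ) → Prop}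
    (h : IsRegularPred S fun x : Option V → ι → ℕ => P (fun a => x (some a)) (x none)) :
    IsRegularPred S fun x => ∃ y, P x y := by
  have := isRegular_paddedLang_image (fun p : Option V × ι => S p.2)
    (fun p : V × ι => (some p.1, p.2)) h
  refine this.congr fun w => ?_
  suffices {v : V × ι → ℕ | ∃ y, P (fun a i => v (a, i)) y} =
      (fun (x : Option V × ι → ℕ) (p : V × ι) => x (some p.1, p.2)) ''
        {v | P (fun a i => v (some a, i)) fun i => v (none, i)} by
    change w ∈ paddedLang (fun p : V × ι => S p.2) _ ↔ _
    rw [this]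
  ext v
  constructor
  · rintro ⟨y, hy⟩
    exact ⟨fun p => p.1.elim (y p.2) fun a => v (a, p.2), hy, rfl⟩
  · rintro ⟨x, hx, rfl⟩
    exact ⟨_, hx⟩

theorem forall_vec {P : (V → ι → ℕ) → (ι → ℕ) → Prop}
    (h : IsRegularPred S fun x : Option V → ι → ℕ => P (fun a => x (some a)) (x none)) :
    IsRegularPred S fun x => ∀ y, P x y := by
  have := (exists_vec (P := fun x y => ¬ P x y) h.not).not
  simpa only [not_exists, not_not] using this

theorem add (hadd : AdditionRecognizable S) (a b c : V) :
    IsRegularPred S fun x => x a + x b = x c :=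
  comp (P := fun x : Fin 3 → ι → ℕ => x 0 + x 1 = x 2)
    (IsRecognizable.isRegular_paddedLang _ hadd) ![a, b, c]

/-- The order on one component is the projection of addition. -/
theorem le_apply (hadd : AdditionRecognizable S) (a b : V) (i : ι) :
    IsRegularPred S fun x => x a i ≤ x b i := by
  have h := isRegular_paddedLang_image (fun p : Fin 3 × ι => S p.2)
    (fun k : Fin 2 => ((![0, 2] : Fin 2 → Fin 3) k, i))
    (IsRecognizable.isRegular_paddedLang _ hadd)
  have h' := isRegular_paddedLang_preimage (fun p : V × ι => S p.2)
    (fun k : Fin 2 => ((![a, b] : Fin 2 → V) k, i)) h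
  refine h'.congr fun w => ?_
  suffices {v : V × ι → ℕ | v (a, i) ≤ v (b, i)} =
      {v | (fun k : Fin 2 => v ((![a, b] : Fin 2 → V) k, i)) ∈
        (fun (x : Fin 3 × ι → ℕ) (k : Fin 2) => x ((![0, 2] : Fin 2 → Fin 3) k, i)) ''
          {v | (fun j => v (0, j)) + (fun j => v (1, j)) = fun j => v (2, j)}} by
    change w ∈ paddedLang (fun p : V × ι => S p.2) {v : V × ι → ℕ | v (a, i) ≤ v (b, i)} ↔ _
    rw [this]
  ext v
  constructor
  · intro (hv : v (a, i) ≤ v (b, i))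
    -- Constant vectors: addition must hold in every component, although only component `i` is kept.
    refine ⟨fun p => ![v (a, i), v (b, i) - v (a, i), v (b, i)] p.1, ?_, ?_⟩
    · funext j
      exact Nat.add_sub_cancel' hv
    · funext k
      fin_cases k <;> rfl
  · rintro ⟨x, hx, hv⟩
    have h0 : x (0, i) = v (a, i) := congrFun hv 0
    have h1 : x (2, i) = v (b, i) := congrFun hv 1
    have h2 : x (0, i) + x (1, i) = x (2, i) := congrFun hx i
    change v (a, i) ≤ v (b, i)
    omega

theorem lt_apply (hadd : AdditionRecognizable S) (a b : V) (i : ι) :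
    IsRegularPred S fun x => x a i < x b i := by
  simpa only [not_le] using (le_apply hadd b a i).not

theorem eq_apply (hadd : AdditionRecognizable S) (a b : V) (i : ι) :
    IsRegularPred S fun x => x a i = x b i := by
  simpa only [← le_antisymm_iff] using (le_apply hadd a b i).and (le_apply hadd b a i)

theorem lex_lt [LinearOrder ι] (hadd : AdditionRecognizable S) (a b : V) :
    IsRegularPred S fun x => toLex (x a) < toLex (x b) := by
  have h : ∀ i, IsRegularPred S fun x : V → ι → ℕ =>
      (∀ j, j < i → x a j = x b j) ∧ x a i < x b i := fun i =>
    (bool (fun j => eq_apply hadd a b j) fun p => ∀ j, j < i → p j).and (lt_apply hadd a b i)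
  exact bool h fun p => ∃ i, p i

/-- Equality of values is a finite disjunction over pairs of states with equal outputs, so nothing
is asked of `K`. -/
theorem automatic_eq {K : Type*} {f : (ι → ℕ) → K} (hf : IsAutomatic S f) (a b : V) :
    IsRegularPred S fun x => f (x a) = f (x b) := by
  obtain ⟨σ, _, M, hM⟩ := hf
  have h : ∀ (c : V) (q : σ), IsRegularPred S fun x : V → ι → ℕ =>
      (multiRep S (x c)).foldl M.step M.start = q := by
    intro c q
    have hL : Language.IsRegular {w : List (Letter A) | w.foldl M.step M.start = q} :=
      ⟨σ, Fintype.ofFinite σ, ⟨M.step, M.start, {q}⟩, rfl⟩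
    exact isRegular_paddedLang_preimage (fun p : V × ι => S p.2) (fun i : ι => (c, i))
      (isRegular_paddedLang_of_multiRep S hL)
  have h' := bool (fun p : σ × σ => (h a p.1).and (h b p.2))
    fun P => ∃ p : σ × σ, M.out p.1 = M.out p.2 ∧ P p
  convert h' using 2 with x
  rw [hM, hM]
  constructor
  · intro he
    exact ⟨(_, _), he, rfl, rfl⟩
  · rintro ⟨p, he, h1, h2⟩
    rwa [DFAO.output, DFAO.output, h1, h2]

end IsRegularPred

end Predicates

end AbstractNumerationSystem

/-! ### Counting fibres of recognizable sets -/

namespace AbstractNumerationSystem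

section Counting

variable {J : Type} [Fintype J] {A : J → Type*} [∀ j, Finite (A j)] [∀ j, LinearOrder (A j)]
  (S : ∀ j, AbstractNumerationSystem (A j))

theorem multiVal_multiRep (n : J → ℕ) : multiVal S (multiRep S n) = n := by
  funext j
  have h := map_pad_apply (fun j => (S j).rep (n j)) j
  rw [List.map_map] at h
  change (S j).val (List.map ((fun b => b j) ∘ Subtype.val) (pad _)).reduceOption = n j
  rw [h, padRow, List.reduceOption_append, List.reduceOption_replicate_none, List.nil_append]
  simp [List.reduceOption, val_rep]

theorem mem_multiLang_iff {w : List (Letter A)} :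
    w ∈ multiLang S ↔ ∃ n, multiRep S n = w := by
  constructor
  · rintro ⟨u, hu, rfl⟩
    exact ⟨fun j => (S j).val (u j), congrArg pad (funext fun j => (S j).rep_val (hu j))⟩
  · rintro ⟨n, rfl⟩
    exact ⟨_, fun j => (S j).rep_mem _, rfl⟩

variable {ι : Type} [Fintype ι] (e : ι → J)

omit [Fintype J] [Fintype ι] [∀ j, Finite (A j)] [∀ j, LinearOrder (A j)] in
theorem map_toLetter_eq_iff {v : List (Letter A)} {w : List (Letter fun i => A (e i))} {k : ℕ} :
    v.map (fun a => toLetter fun i => a.1 (e i)) = List.replicate k none ++ w.map some ↔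
      (v.map Subtype.val).map (fun b i => b (e i)) =
        List.replicate k (fun _ => none) ++ w.map Subtype.val := by
  constructor
  · intro h
    have := congrArg (List.map fun o : Option (Letter fun i => A (e i)) =>
      o.elim (fun _ => none) Subtype.val) h
    rw [List.map_append, List.map_replicate, List.map_map, List.map_map] at this
    rw [List.map_map]
    refine Eq.trans (List.map_congr_left fun a _ => ?_) this
    by_cases ha : (fun i => a.1 (e i)) = fun _ => none
    · simp only [Function.comp_apply, ha, toLetter_none, Option.elim_none]
    · simp [toLetter, ha]
  · intro h
    have := congrArg (List.map toLetter) h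
    rw [List.map_append, List.map_replicate, toLetter_none, List.map_map, List.map_map] at this
    refine this.trans (congrArg _ ?_)
    rw [List.map_map]
    exact List.map_congr_left fun a _ => toLetter_val a

/-- The number of elements of a recognizable set with given components along `e` is a regular
sequence, as soon as it is finite. -/
theorem isRegularSeq_ncard {T : Set (J → ℕ)} (hT : (paddedLang S T).IsRegular)
    (hfin : ∀ s : ι → ℕ, {x | x ∈ T ∧ (fun i => x (e i)) = s}.Finite) :
    IsRegularSeq (fun i => S (e i)) fun s => {x | x ∈ T ∧ (fun i => x (e i)) = s}.ncard := by
  obtain ⟨L, hL, hmem⟩ : ∃ L : Language (Letter A), L.IsRegular ∧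
      ∀ v, v ∈ L ↔ ∃ x ∈ T, multiRep S x = v :=
    ⟨_, hT.preimage_map Subtype.val, fun v => map_val_mem_paddedLang_iff S⟩
  -- The counted words are the representations of the elements of `T` above `w`; their deleted
  -- columns are those where only forgotten rows are nonblank.
  have hset : ∀ w : List (Letter fun i => A (e i)),
      {v | v ∈ L ∧ ∃ k, v.map (fun a => toLetter fun i => a.1 (e i)) =
        List.replicate k none ++ w.map some} =
      multiRep S '' {x | x ∈ T ∧ multiRep (fun i => S (e i)) (fun i => x (e i)) = w} := by
    intro w
    ext v
    simp only [map_toLetter_eq_iff]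
    constructor
    · rintro ⟨hv, k, hk⟩
      obtain ⟨x, hx, rfl⟩ := (hmem v).mp hv
      have hw := map_mem_paddedLang S e
        ((map_val_mem_paddedLang_iff S).mpr (Set.mem_image_of_mem _ (Set.mem_singleton x))) hk
      obtain ⟨_, ⟨y, hy, rfl⟩, hyw⟩ := (map_val_mem_paddedLang_iff _).mp hw
      rw [Set.mem_singleton_iff.mp hy] at hyw
      exact ⟨x, ⟨hx, hyw⟩, rfl⟩
    · rintro ⟨x, ⟨hx, rfl⟩, rfl⟩
      refine ⟨(hmem _).mpr ⟨x, hx, rfl⟩, ?_⟩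
      have hm := map_mem_paddedLang S e (k := 0)
        ((map_val_mem_paddedLang_iff S).mpr (Set.mem_image_of_mem _ (Set.mem_singleton x))) rfl
      obtain ⟨_, ⟨y, hy, rfl⟩, k, hk⟩ := (mem_paddedLang_iff _).mp hm
      rw [Set.mem_singleton_iff.mp hy] at hk
      exact ⟨k, hk⟩
  have : Finite (Letter A) := Subtype.finite
  -- Outside the numeration language the fibre is empty, in agreement with the value 0 of
  -- `seqSeries`.
  have hw : ∀ w : List (Letter fun i => A (e i)),
      (w ∈ multiLang (fun i => S (e i)) ∧
        {x | x ∈ T ∧ multiRep (fun i => S (e i)) (fun i => x (e i)) = w} =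
          {x | x ∈ T ∧ (fun i => x (e i)) = multiVal (fun i => S (e i)) w}) ∨
      (w ∉ multiLang (fun i => S (e i)) ∧
        {x | x ∈ T ∧ multiRep (fun i => S (e i)) (fun i => x (e i)) = w} = ∅) := by
    intro w
    by_cases h : w ∈ multiLang (fun i => S (e i))
    · refine Or.inl ⟨h, ?_⟩
      obtain ⟨n, rfl⟩ := (mem_multiLang_iff _).mp h
      ext x
      simp only [Set.mem_ofPred_eq, multiVal_multiRep, (multiRep_injective _).eq_iff]
    · refine Or.inr ⟨h, Set.eq_empty_of_forall_notMem ?_⟩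
      rintro x ⟨-, hx⟩
      exact h ((mem_multiLang_iff _).mpr ⟨_, hx⟩)
  have hser := hL.isRecognizableSeries_ncard
    (fun a => toLetter fun i => a.1 (e i)) (fun w => by
      rw [hset]
      rcases hw w with ⟨-, h⟩ | ⟨-, h⟩ <;> rw [h]
      · exact (hfin _).image _
      · simp)
  unfold IsRegularSeq
  convert hser using 1
  funext w
  rw [hset, Set.ncard_image_of_injective _ (multiRep_injective S), seqSeries]
  rcases hw w with ⟨hm, h⟩ | ⟨hm, h⟩ <;> rw [h]
  · rw [if_pos hm]
  · rw [if_neg hm, Set.ncard_empty]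

end Counting

/-! ### First occurrences of factors -/

section FactorComplexity

variable {ι : Type} [Fintype ι] {A : ι → Type*} [∀ i, Finite (A i)] [∀ i, LinearOrder (A i)]
  {S : ∀ i, AbstractNumerationSystem (A i)} {K : Type*} {f : (ι → ℕ) → K}

omit [Fintype ι] in
theorem factorAt_eq_iff {p q s : ι → ℕ} :
    factorAt f p s = factorAt f q s ↔ ∀ i : ι → ℕ, (∀ c, i c < s c) → f (p + i) = f (q + i) :=
  ⟨fun h i hi => congrFun h fun c => ⟨i c, hi c⟩, fun h => funext fun j => h _ fun c => (j c).2⟩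

theorem IsRegularPred.factorAt_eq {V : Type} [Fintype V] (hadd : AdditionRecognizable S)
    (hf : IsAutomatic S f) (p q s : V) :
    IsRegularPred S fun x => factorAt f (x p) (x s) = factorAt f (x q) (x s) := by
  -- Addition is available only as a relation, so the sums `p + i` and `q + i` get names `y` and
  -- `z`. After the three quantifiers, `some (some none)`, `some none` and `none` stand for `i`, `y`
  -- and `z`.
  have h : IsRegularPred S fun x : V → ι → ℕ => ∀ i : ι → ℕ, (∀ c, i c < x s c) →
      ∀ y z, x p + i = y → x q + i = z → f y = f z := by
    refine forall_vec (imp (bool (fun c => lt_apply hadd none (some s) c) fun P => ∀ c, P c) ?_)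
    refine forall_vec (forall_vec ?_)
    exact (add hadd (some (some (some p))) (some (some none)) (some none)).imp
      ((add hadd (some (some (some q))) (some (some none)) none).imp
        (automatic_eq hf (some none) none))
  convert h using 2 with x
  rw [factorAt_eq_iff]
  exact forall₂_congr fun i _ => ⟨by rintro h _ _ rfl rfl; exact h, fun h => h _ _ rfl rfl⟩

/-- An automatic sequence has finitely many factors of each size. -/
theorem IsAutomatic.finite_range_factorAt (hf : IsAutomatic S f) (s : ι → ℕ) :
    (Set.range fun p => factorAt f p s).Finite := by
  obtain ⟨σ, _, M, hM⟩ := hf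
  -- Every factor is the output of a box filled with states, and there are finitely many such boxes.
  refine (Set.finite_range fun (g : (∀ i, Fin (s i)) → σ) j => M.out (g j)).subset ?_
  rintro _ ⟨p, rfl⟩
  exact ⟨fun j => (multiRep S fun i => p i + j i).foldl M.step M.start,
    funext fun j => (hM _).symm⟩

/-- The position `p` is the first occurrence, in the lexicographic order, of the factor of size `s`
that occurs there. -/
def IsFirstOccurrence [LinearOrder ι] (f : (ι → ℕ) → K) (s p : ι → ℕ) : Prop :=
  ∀ q, factorAt f q s = factorAt f p s → ¬ toLex q < toLex p

theorem IsRegularPred.isFirstOccurrence [LinearOrder ι] (hadd : AdditionRecognizable S)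
    (hf : IsAutomatic S f) :
    IsRegularPred S fun x : Fin 2 → ι → ℕ => IsFirstOccurrence f (x 0) (x 1) :=
  forall_vec ((factorAt_eq hadd hf none (some 1) (some 0)).imp (lex_lt hadd none (some 1)).not)

omit [Fintype ι] in
theorem injOn_factorAt [LinearOrder ι] [WellFoundedLT ι] (f : (ι → ℕ) → K) (s : ι → ℕ) :
    Set.InjOn (fun p => factorAt f p s) {p | IsFirstOccurrence f s p} := by
  intro p hp q hq h
  exact toLex.injective (le_antisymm (not_lt.mp (hp q h.symm)) (not_lt.mp (hq p h)))

/-- The lexicographic order on vectors is well-founded, `ι` being finite, so every factor has a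
least position. -/
theorem image_factorAt [LinearOrder ι] (f : (ι → ℕ) → K) (s : ι → ℕ) :
    (fun p => factorAt f p s) '' {p | IsFirstOccurrence f s p} =
      Set.range fun p => factorAt f p s := by
  refine Set.Subset.antisymm (Set.image_subset_range _ _) ?_
  rintro _ ⟨p, rfl⟩
  obtain ⟨q, hq, hmin⟩ := (wellFounded_lt (α := Lex (ι → ℕ))).has_min
    {q | factorAt f (ofLex q) s = factorAt f p s} ⟨toLex p, rfl⟩
  exact ⟨ofLex q, fun q' hq' => hmin (toLex q') (hq'.trans hq), hq⟩

theorem exists_isRegularSeq_factorComplexity [LinearOrder ι] (hadd : AdditionRecognizable S)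
    (hf : IsAutomatic S f) :
    ∃ ρ : (ι → ℕ) → ℕ, (∀ s, factorComplexity f s = (ρ s : ℕ∞)) ∧ IsRegularSeq S ρ := by
  -- Block 0 holds the size and block 1 the position; fixing block 0 leaves the first occurrences
  -- for that size.
  have himage : ∀ s : ι → ℕ, (fun (x : Fin 2 × ι → ℕ) i => x (1, i)) ''
      {x | x ∈ {x : Fin 2 × ι → ℕ |
        IsFirstOccurrence f (fun i => x (0, i)) fun i => x (1, i)} ∧ (fun i => x (0, i)) = s} =
      {p | IsFirstOccurrence f s p} := by
    intro s
    ext p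
    constructor
    · rintro ⟨x, ⟨hx, rfl⟩, rfl⟩
      exact hx
    · intro hp
      exact ⟨fun k => (![s, p] : Fin 2 → ι → ℕ) k.1 k.2, ⟨hp, rfl⟩, rfl⟩
  have hinj : ∀ s : ι → ℕ, Set.InjOn (fun (x : Fin 2 × ι → ℕ) i => x (1, i))
      {x | x ∈ {x : Fin 2 × ι → ℕ |
        IsFirstOccurrence f (fun i => x (0, i)) fun i => x (1, i)} ∧ (fun i => x (0, i)) = s} := by
    rintro s x ⟨-, rfl⟩ y ⟨-, hy⟩ h
    funext ⟨k, i⟩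
    fin_cases k
    · exact (congrFun hy i).symm
    · exact congrFun h i
  have hfin : ∀ s : ι → ℕ, {p | IsFirstOccurrence f s p}.Finite := fun s =>
    Set.Finite.of_finite_image (by rw [image_factorAt]; exact hf.finite_range_factorAt s)
      (injOn_factorAt f s)
  have hfin' := fun s => Set.Finite.of_finite_image (by rw [himage]; exact hfin s) (hinj s)
  refine ⟨_, fun s => ?_, isRegularSeq_ncard (fun p : Fin 2 × ι => S p.2) (fun i => (0, i))
    (IsRegularPred.isFirstOccurrence hadd hf) hfin'⟩
  rw [(hfin' s).cast_ncard_eq, ← (hinj s).encard_image, himage, ← (injOn_factorAt f s).encard_image,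
    image_factorAt]
  rfl

end FactorComplexity

end AbstractNumerationSystem

theorem mainTheorem7 {d : ℕ} {A : Fin d → Type*} [∀ i, Finite (A i)] [∀ i, LinearOrder (A i)]
    (S : ∀ i, AbstractNumerationSystem (A i))
    (hadd : AbstractNumerationSystem.AdditionRecognizable S)
    {K : Type*} (f : (Fin d → ℕ) → K) (hf : AbstractNumerationSystem.IsAutomatic S f) :
    ∃ ρ : (Fin d → ℕ) → ℕ, (∀ s, factorComplexity f s = (ρ s : ℕ∞)) ∧
      AbstractNumerationSystem.IsRegularSeq S ρ :=
  AbstractNumerationSystem.exists_isRegularSeq_factorComplexity hadd hf
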